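/- Let $n\ge 3$ vehicles have positions $z_i\in\mathbb{R}^2$, $i=1,\dots,n$ (indices modulo $n$). Put $e_i=z_{i+1}-z_i$, $g_i=e_i/\|e_i\|$ and $P_i=I-g_ig_i^{\mathsf T}$. Let target angles $\theta_i^*\in[0,2\pi)$ be given with $\theta_i^*\neq 0$ and $\theta_i^*\neq\pi$ for all $i$. Define the angle errors $\varepsilon_i=-g_i^{\mathsf T}g_{i-1}-\cos\theta_i^*$ (that is, $\cos\theta_i-\cos\theta_i^*$, where $\theta_i$ is the counterclockwise angle from $-g_{i-1}$ to $g_i$), and $V(\varepsilon)=\sum_i|\varepsilon_i|$. The vehicles move by the law $\dot z_i=\operatorname{sgn}(\varepsilon_i)(g_i-g_{i-1})$. For a vector field $f$ let $\mathcal F[f](x)=\bigcap_{r>0}\bigcap_{\mu(S)=0}\overline{\mathrm{co}}\,f(B(x,r)\setminus S)$, where $\mu$ is Lebesgue measure. A Filippov solution of $\dot x=f(t,x)$ on $[0,T]$ is an absolutely continuous $x$ with $\dot x(t)\in\mathcal F[f(t,\cdot)](x(t))$ for almost every $t$. A solution of the closed loop on $[0,T]$ means either a Filippov solution $z$ of the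 law above, or an absolutely continuous $z$ such that for almost every $t$ there is $\eta\in\mathcal F[\operatorname{sgn}](\varepsilon(t))$ with $\dot z_i=\eta_i(g_i-g_{i-1})$ for all $i$. Here $\varepsilon(t)$ is the error of $z(t)$, $\operatorname{sgn}$ acts componentwise, and $g_i$ is read as $0$ if $e_i=0$. Let $A=A(z)\in\mathbb R^{n\times n}$ have entries $a_{i(i-1)}=\frac{1}{\|e_{i-1}\|}g_i^{\mathsf T}P_{i-1}g_{i-2}$, $a_{ii}=\frac{1}{\|e_{i-1}\|}g_i^{\mathsf T}P_{i-1}g_i+\frac1{\|e_i\|}g_{i-1}^{\mathsf T}P_ig_{i-1}$, $a_{i(i+1)}=\frac1{\|e_i\|}g_{i-1}^{\mathsf T}P_ig_{i+1}$, all other entries being zero. Then the equilibrium $\varepsilon=0$ of $\dot\varepsilon=-A\operatorname{sgn}(\varepsilon)$ is locally finite-time stable, with collision avoidance, in the following sense. For every $L>0$ there is $\kappa>0$ (depending only on $n$, $\theta^*$, $L$), and for every $d>0$ there is $\delta>0$ (depending only on $n,\theta^*,L,d$), such that for every initial formation $z(0)$ with $\|z_i(0)-z_j(0)\|\ge d$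 for all $i\ne j$, $\sum_i\|e_i(0)\|\le L$ and $V(\varepsilon(0))<\delta$: (1) $V(\varepsilon(0))/\kappa<T^*$, where $T^*=\frac14\min_{i\ne j}\|z_i(0)-z_j(0)\|$. (2) For every $T\ge 0$ and every solution $z$ of the closed loop on $[0,T]$ starting at $z(0)$, no two vehicles are collocated at any time $t\in[0,T]$ with $t<T^*$. (3) For every such solution and every $t\in[0,T]$ such that no two vehicles are collocated at any time in $[0,t]$ (by (2), in particular for every $t\in[0,T]$ with $t<T^*$), the error is a Filippov solution of $\dot\varepsilon=-A(z(\cdot))\operatorname{sgn}(\varepsilon)$ on $[0,t]$, it satisfies $V(\varepsilon(t))\le V(\varepsilon(0))$, and $\varepsilon(t)=0$ if $t\ge V(\varepsilon(0))/\kappa$. -/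

import Mathlib

open MeasureTheory Set
open scoped Matrix

namespace CircularFormation

noncomputable section

/-! ### Filippov solutions -/

/-- The Filippov set-valued map of a vector field `f`: the intersection, over all radii `r > 0`
and all null sets `S`, of the closed convex hulls of `f (B(x, r) \ S)`. -/
def filippov {E : Type*} [NormedAddCommGroup E] [NormedSpace ℝ E] [MeasureSpace E]
    (f : E → E) (x : E) : Set E :=
  ⋂ r : {r : ℝ // 0 < r}, ⋂ S : {S : Set E // volume S = 0},
    closure (convexHull ℝ (f '' (Metric.ball x r.1 \ S.1)))

/-- `x` is a Filippov solution on `[0, T]` of `ẋ(t) = f t (x(t))`: it is absolutely continuous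
on `[0, T]` and `ẋ(t) ∈ F[f t](x(t))` for almost every `t ∈ [0, T]`. -/
def IsFilippovSolution {E : Type*} [NormedAddCommGroup E] [NormedSpace ℝ E] [MeasureSpace E]
    (f : ℝ → E → E) (x : ℝ → E) (T : ℝ) : Prop :=
  AbsolutelyContinuousOnInterval x 0 T ∧
    ∀ᵐ t ∂(volume.restrict (Icc 0 T)), ∃ v ∈ filippov (f t) (x t), HasDerivAt x v t

/-! ### Formations of `n` vehicles on a circular graph; indices are modulo `n` -/

/-- The plane with the Euclidean norm. -/
abbrev Plane : Type := EuclideanSpace ℝ (Fin 2)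

/-- Positions `z i` of the `n` vehicles. -/
abbrev Config (n : ℕ) : Type := Fin n → Plane

/-- The edge `e_i = z_{i+1} - z_i`. -/
def edge {n : ℕ} [NeZero n] (z : Config n) (i : Fin n) : Plane := z (i + 1) - z i

/-- The bearing `g_i = e_i / ‖e_i‖` (it is `0` if the vehicles `i` and `i + 1` are collocated). -/
def bearing {n : ℕ} [NeZero n] (z : Config n) (i : Fin n) : Plane :=
  ‖edge z i‖⁻¹ • edge z i

/-- No two vehicles are collocated. -/
def NoCollision {n : ℕ} (z : Config n) : Prop := ∀ i j : Fin n, i ≠ j → z i ≠ z j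

/-- The angle errors `ε_i = cos θ_i - cos θ_i* = -g_iᵀ g_{i-1} - cos θ_i*`, where `θ_i` is the
angle from `-g_{i-1}` to `g_i`. -/
def angleError {n : ℕ} [NeZero n] (θs : Fin n → ℝ) (z : Config n) : Fin n → ℝ :=
  fun i => -(inner ℝ (bearing z i) (bearing z (i - 1))) - Real.cos (θs i)

/-- The componentwise sign function. -/
def sgn {n : ℕ} (x : Fin n → ℝ) : Fin n → ℝ := fun i => Real.sign (x i)

/-- The Lyapunov function `V(ε) = ∑ |ε_i|`. -/
def V {n : ℕ} (x : Fin n → ℝ) : ℝ := ∑ i, |x i|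

/-- The closed loop `ż_i = sgn(ε_i) (g_i - g_{i-1})`. -/
def closedLoop {n : ℕ} [NeZero n] (θs : Fin n → ℝ) (z : Config n) : Config n :=
  fun i => sgn (angleError θs z) i • (bearing z i - bearing z (i - 1))

/-- Solutions of the closed loop on `[0, T]` when only the discontinuous factor `sgn(ε)` is
regularised, as a function of `ε`: `ż_i = η_i (g_i - g_{i-1})` for some `η ∈ F[sgn](ε)`. -/
def IsSignInclusionSolution {n : ℕ} [NeZero n] (θs : Fin n → ℝ) (z : ℝ → Config n) (T : ℝ) :
    Prop :=
  AbsolutelyContinuousOnInterval z 0 T ∧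
    ∀ᵐ t ∂(volume.restrict (Icc 0 T)), ∃ η ∈ filippov sgn (angleError θs (z t)),
      HasDerivAt z (fun i => η i • (bearing (z t) i - bearing (z t) (i - 1))) t

/-- The projection `P_i x = (I - g_i g_iᵀ) x`. -/
def proj {n : ℕ} [NeZero n] (z : Config n) (i : Fin n) (x : Plane) : Plane :=
  x - inner ℝ (bearing z i) x • bearing z i

/-- The matrix `A` of the error system `ε̇ = -A sgn(ε)`, for the formation `z`. (For `n ≥ 3` the
indices `i - 1`, `i`, `i + 1` are distinct.) -/
def errorMatrix {n : ℕ} [NeZero n] (z : Config n) : Matrix (Fin n) (Fin n) ℝ :=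
  Matrix.of fun i j =>
    if j = i - 1 then
      ‖edge z (i - 1)‖⁻¹ * inner ℝ (bearing z i) (proj z (i - 1) (bearing z (i - 1 - 1)))
    else if j = i then
      ‖edge z (i - 1)‖⁻¹ * inner ℝ (bearing z i) (proj z (i - 1) (bearing z i))
        + ‖edge z i‖⁻¹ * inner ℝ (bearing z (i - 1)) (proj z i (bearing z (i - 1)))
    else if j = i + 1 then
      ‖edge z i‖⁻¹ * inner ℝ (bearing z (i - 1)) (proj z i (bearing z (i + 1)))
    else 0

/-- The right-hand side `x ↦ -A(z(t)) sgn(x)` of the error system along the motion `z`. -/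
def errorField {n : ℕ} [NeZero n] (z : ℝ → Config n) (t : ℝ) (x : Fin n → ℝ) : Fin n → ℝ :=
  -(errorMatrix (z t) *ᵥ sgn x)

/-- `T* = min_{i ≠ j} ‖z_i - z_j‖ / 4`. -/
def collisionTime {n : ℕ} (z : Config n) : ℝ :=
  (⨅ p : {p : Fin n × Fin n // p.1 ≠ p.2}, ‖z p.1.1 - z p.1.2‖) / 4

end

end CircularFormation

/-! Let s_i be the sine of the turn from g_{i-1} to g_i. Along a motion with signs η one has dV/dt =
-ηᵀAη, and grouping by edges gives ηᵀAη = ∑ (η_{i+1} s_{i+1} - η_i s_i)² / ‖e_i‖ ≥ 0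
(`sum_mul_errorMatrix_mulVec`). This degenerates only if η_i s_i is constant in i, and closedness of
the polygon excludes that when ε ≠ 0 is small. The signed turning angles ±arccos(g_iᵀg_{i-1}) sum to
a multiple of 2π, which for small ε must equal the sum of the target angles with the same
orientations. Hence the errors cannot all push the signed angles one way, and η_i s_i takes a value
≥ m and a value ≤ -m, where m > 0 bounds |s_i| from below because θ_i* is neither 0 nor π.
Cauchy–Schwarz then gives dissipation at least (2m)²/perimeter (`exists_dissipation_rate`).

Two points make this rigorous for nonsmooth solutions. At almost every time with ε_i = 0 also ε_i' =
0, so the undetermined value of η_i does not affect dV/dt. And all speeds are at most 2, even at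
collisions, so up to T* no vehicles meet before the error has settled and the perimeter at most
doubles, which makes the rate uniform. -/

open Filter Topology

/-! ### Absolute continuity: closure properties and growth bounds. -/

namespace AbsolutelyContinuousOnInterval

/-- The total increment of `g` over a family of disjoint intervals is squeezed between 0 and a
combination of those of the `f i`. The closure properties below are instances of this. -/
theorem of_dist_le_sum {ι X : Type*} {Y : ι → Type*} [PseudoMetricSpace X]
    [∀ i, PseudoMetricSpace (Y i)] {s : Finset ι} {f : (i : ι) → ℝ → Y i} {g : ℝ → X} {a b : ℝ}
    (K : ι → ℝ) (hf : ∀ i ∈ s, AbsolutelyContinuousOnInterval (f i) a b)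
    (h : ∀ x ∈ uIcc a b, ∀ y ∈ uIcc a b, dist (g x) (g y) ≤ ∑ i ∈ s, K i * dist (f i x) (f i y)) :
    AbsolutelyContinuousOnInterval g a b := by
  have hlim := tendsto_finsetSum s fun i hi => Filter.Tendsto.const_mul (K i) (hf i hi)
  simp only [mul_zero, Finset.sum_const_zero] at hlim
  refine tendsto_of_tendsto_of_tendsto_of_le_of_le' tendsto_const_nhds hlim
    (Eventually.of_forall fun E => Finset.sum_nonneg fun i _ => dist_nonneg) ?_
  refine eventually_inf_principal.2 (Eventually.of_forall fun E hE => ?_)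
  simp only [Finset.mul_sum]
  rw [Finset.sum_comm]
  refine Finset.sum_le_sum fun i hi => ?_
  have := hE.1 i hi
  exact h _ this.1 _ this.2

theorem of_dist_le {X Y : Type*} [PseudoMetricSpace X] [PseudoMetricSpace Y] {f : ℝ → Y}
    {g : ℝ → X} {a b : ℝ} (K : ℝ) (hf : AbsolutelyContinuousOnInterval f a b)
    (h : ∀ x ∈ uIcc a b, ∀ y ∈ uIcc a b, dist (g x) (g y) ≤ K * dist (f x) (f y)) :
    AbsolutelyContinuousOnInterval g a b :=
  of_dist_le_sum (s := {()}) (f := fun _ : Unit => f) (fun _ => K) (fun _ _ => hf)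
    (by simpa using h)

theorem pi {ι : Type*} [Fintype ι] {X : ι → Type*} [∀ i, PseudoMetricSpace (X i)]
    {f : ℝ → ∀ i, X i} {a b : ℝ}
    (hf : ∀ i, AbsolutelyContinuousOnInterval (fun t => f t i) a b) :
    AbsolutelyContinuousOnInterval f a b := by
  refine of_dist_le_sum (s := Finset.univ) (f := fun i t => f t i) (fun _ => 1)
    (fun i _ => hf i) fun x _ y _ => ?_
  simp only [one_mul]
  refine (dist_pi_le_iff (Finset.sum_nonneg fun _ _ => dist_nonneg)).2 fun i => ?_
  exact Finset.single_le_sum (f := fun i => dist (f x i) (f y i)) (fun _ _ => dist_nonneg)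
    (Finset.mem_univ i)

theorem apply {ι : Type*} [Fintype ι] {X : ι → Type*} [∀ i, PseudoMetricSpace (X i)]
    {f : ℝ → ∀ i, X i} {a b : ℝ} (hf : AbsolutelyContinuousOnInterval f a b) (i : ι) :
    AbsolutelyContinuousOnInterval (fun t => f t i) a b :=
  hf.of_dist_le 1 fun x _ y _ => by simpa using dist_le_pi_dist (f x) (f y) i

theorem norm {E : Type*} [SeminormedAddCommGroup E] {f : ℝ → E} {a b : ℝ}
    (hf : AbsolutelyContinuousOnInterval f a b) :
    AbsolutelyContinuousOnInterval (fun t => ‖f t‖) a b :=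
  hf.of_dist_le 1 fun x _ y _ => by
    rw [one_mul, dist_eq_norm (f x)]; exact dist_norm_norm_le (f x) (f y)

theorem inv {f : ℝ → ℝ} {a b : ℝ} (hf : AbsolutelyContinuousOnInterval f a b)
    (h0 : ∀ t ∈ uIcc a b, 0 < f t) :
    AbsolutelyContinuousOnInterval (fun t => (f t)⁻¹) a b := by
  obtain ⟨t₀, ht₀, hmin⟩ := isCompact_uIcc.exists_isMinOn nonempty_uIcc hf.continuousOn
  have hm := h0 t₀ ht₀
  refine hf.of_dist_le ((f t₀)⁻¹ * (f t₀)⁻¹) fun x hx y hy => ?_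
  have hx0 := h0 x hx
  have hy0 := h0 y hy
  rw [Real.dist_eq, Real.dist_eq, inv_sub_inv hx0.ne' hy0.ne', abs_div, abs_sub_comm,
    abs_of_pos (mul_pos hx0 hy0), div_eq_inv_mul, mul_inv]
  gcongr
  · exact hmin hx
  · exact hmin hy

theorem real_inner {E : Type*} [NormedAddCommGroup E] [InnerProductSpace ℝ E] {f g : ℝ → E} {a b : ℝ}
    (hf : AbsolutelyContinuousOnInterval f a b) (hg : AbsolutelyContinuousOnInterval g a b) :
    AbsolutelyContinuousOnInterval (fun t => inner ℝ (f t) (g t)) a b := by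
  obtain ⟨C, hC⟩ := hf.exists_bound
  obtain ⟨D, hD⟩ := hg.exists_bound
  refine of_dist_le_sum (s := Finset.univ) (f := fun c : Bool => if c then f else g)
    (fun c => if c then D else C) (by simp [hf, hg]) fun x hx y hy => ?_
  have key : inner ℝ (f x) (g x) - inner ℝ (f y) (g y)
      = inner ℝ (f x - f y) (g x) + inner ℝ (f y) (g x - g y) := by
    rw [inner_sub_left, inner_sub_right]; ring
  simp only [Fintype.sum_bool, if_true, Bool.false_eq_true, if_false]
  rw [Real.dist_eq, key, dist_eq_norm, dist_eq_norm]
  refine (abs_add_le _ _).trans (add_le_add ?_ ?_)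
  · refine (abs_real_inner_le_norm _ _).trans ?_
    rw [mul_comm]; gcongr; exact hD x hx
  · refine (abs_real_inner_le_norm _ _).trans ?_
    gcongr; exact hC y hy

theorem le_add_of_ae_deriv_le {f : ℝ → ℝ} {a b c : ℝ} (hab : a ≤ b)
    (hf : AbsolutelyContinuousOnInterval f a b)
    (h : ∀ᵐ t ∂(volume.restrict (Icc a b)), deriv f t ≤ c) : f b ≤ f a + c * (b - a) := by
  have h1 := hf.integral_deriv_eq_sub
  have h2 : ∫ t in a..b, deriv f t ≤ ∫ _ in a..b, c :=
    intervalIntegral.integral_mono_ae_restrict hab hf.intervalIntegrable_deriv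
      (by simp) h
  rw [h1] at h2
  simp at h2
  linarith

theorem norm_sub_le_of_ae_hasDerivAt {E : Type*} [NormedAddCommGroup E] [InnerProductSpace ℝ E]
    {f : ℝ → E} {a b C : ℝ} (hab : a ≤ b) (hf : AbsolutelyContinuousOnInterval f a b)
    (h : ∀ᵐ t ∂(volume.restrict (Icc a b)), ∃ v, ‖v‖ ≤ C ∧ HasDerivAt f v t) :
    ‖f b - f a‖ ≤ C * (b - a) := by
  set w := f b - f a with hw
  rcases eq_or_ne w 0 with h0 | h0
  · rw [h0, norm_zero]
    rcases hab.eq_or_lt with rfl | hlt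
    · simp
    have : (ae (volume.restrict (Icc a b))).NeBot := by
      -- For `w = 0` only `0 ≤ C` is needed; an interval of positive length contains a point where
      -- the hypothesis holds.
      rw [ae_neBot, Ne, Measure.restrict_eq_zero]; simp [hlt]
    obtain ⟨t, v, hv, -⟩ := h.exists
    exact mul_nonneg ((norm_nonneg _).trans hv) (sub_nonneg.2 hab)
  have hconst : AbsolutelyContinuousOnInterval (fun _ : ℝ => w) a b :=
    hf.of_dist_le 0 (by simp)
  -- Pairing with the increment `w` itself reduces the vector inequality to the real one.
  have h1 := (hconst.real_inner hf).le_add_of_ae_deriv_le (c := ‖w‖ * C) hab (by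
    filter_upwards [h] with t ⟨v, hv, hd⟩
    have h2 := (hasDerivAt_const t w).inner ℝ hd
    rw [h2.deriv, inner_zero_left, add_zero]
    exact (real_inner_le_norm _ _).trans (by gcongr))
  have h2 : ‖w‖ * ‖w‖ ≤ ‖w‖ * (C * (b - a)) := by
    rw [← real_inner_self_eq_norm_mul_norm]
    nth_rw 2 [hw]
    rw [inner_sub_right]
    linarith
  exact le_of_mul_le_mul_left h2 (norm_pos_iff.2 h0)

end AbsolutelyContinuousOnInterval

/-! ### Differentiating absolute values. -/

/-- A zero of `f` is a minimum of `|f|`, so `|f|` has derivative 0 there; then `|f|`, hence `f`, is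
little-o of the increment. -/
theorem eq_zero_of_hasDerivAt_of_differentiableAt_abs {f : ℝ → ℝ} {f' t : ℝ}
    (hf : HasDerivAt f f' t) (h0 : f t = 0) (habs : DifferentiableAt ℝ (fun s => |f s|) t) :
    f' = 0 ∧ HasDerivAt (fun s => |f s|) 0 t := by
  have hmin : IsLocalMin (fun s => |f s|) t :=
    Eventually.of_forall fun s => by simp [h0]
  have hd : HasDerivAt (fun s => |f s|) 0 t := by
    rw [← hmin.deriv_eq_zero]; exact habs.hasDerivAt
  refine ⟨hf.unique ?_, hd⟩
  rw [hasDerivAt_iff_isLittleO] at hd ⊢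
  simp only [h0, abs_zero, sub_zero, smul_zero] at hd ⊢
  exact hd.of_abs_left

/-- At a zero `f'` vanishes, so any `η` serves. This is what makes the choice of sign in the
Filippov set irrelevant where an error is zero. -/
theorem hasDerivAt_abs_comp {f : ℝ → ℝ} {f' t η : ℝ} (hf : HasDerivAt f f' t)
    (habs : DifferentiableAt ℝ (fun s => |f s|) t) (hη : f t ≠ 0 → η = Real.sign (f t)) :
    HasDerivAt (fun s => |f s|) (η * f') t := by
  rcases lt_trichotomy (f t) 0 with h | h | h
  · rw [hη h.ne, Real.sign_of_neg h]
    refine (hf.neg.congr_of_eventuallyEq ?_).congr_deriv (by ring)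
    filter_upwards [hf.continuousAt.eventually_lt_const h] with s hs
    exact abs_of_neg hs
  · obtain ⟨rfl, hd⟩ := eq_zero_of_hasDerivAt_of_differentiableAt_abs hf h habs
    simpa using hd
  · rw [hη h.ne', Real.sign_of_pos h]
    refine (hf.congr_of_eventuallyEq ?_).congr_deriv (by ring)
    filter_upwards [hf.continuousAt.eventually_const_lt h] with s hs
    exact abs_of_pos hs

/-! ### Turning angles of closed polygons, and variation around a cycle. -/

namespace CircularFormation

/-- For small `x`, the signed sum of the angles `arccos (-x i - c i)` cannot jump to another
multiple of `2π`. -/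
theorem exists_signed_arccos_sum_eq {n : ℕ} [NeZero n] (c : Fin n → ℝ) (hc : ∀ i, c i ^ 2 < 1) :
    ∃ m > 0, ∃ δ > 0, ∀ x : Fin n → ℝ, V x < δ →
      (∀ i, m ^ 2 ≤ 1 - (-x i - c i) ^ 2) ∧
      ∀ (S : Finset (Fin n)) (k : ℤ),
        ∑ i, (if i ∈ S then Real.arccos (-x i - c i) else -Real.arccos (-x i - c i))
            = k * (2 * Real.pi) →
          ∑ i, (if i ∈ S then Real.arccos (-x i - c i) else -Real.arccos (-x i - c i))
            = ∑ i, (if i ∈ S then Real.arccos (-c i) else -Real.arccos (-c i)) := by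
  obtain ⟨i₀, hi₀⟩ := Finite.exists_min fun i => 1 - c i ^ 2
  have hpos : 0 < 1 - c i₀ ^ 2 := sub_pos.2 (hc i₀)
  -- Half of the smallest squared sine at `x = 0` leaves room for a perturbation.
  set m := Real.sqrt ((1 - c i₀ ^ 2) / 2) with hm
  have hm2 : m ^ 2 = (1 - c i₀ ^ 2) / 2 := Real.sq_sqrt (by positivity)
  have hev : ∀ᶠ x : Fin n → ℝ in 𝓝 0, (∀ i, m ^ 2 < 1 - (-x i - c i) ^ 2) ∧
      ∀ (S : Finset (Fin n)) (k : ℤ),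
        ∑ i, (if i ∈ S then Real.arccos (-x i - c i) else -Real.arccos (-x i - c i))
            = k * (2 * Real.pi) →
          ∑ i, (if i ∈ S then Real.arccos (-x i - c i) else -Real.arccos (-x i - c i))
            = ∑ i, (if i ∈ S then Real.arccos (-c i) else -Real.arccos (-c i)) := by
    refine eventually_and.2 ⟨eventually_all.2 fun i => ?_, eventually_all.2 fun S => ?_⟩
    · have hcont : ContinuousAt (fun x : Fin n → ℝ => 1 - (-x i - c i) ^ 2) 0 :=
        (by fun_prop : Continuous fun x : Fin n → ℝ => 1 - (-x i - c i) ^ 2).continuousAt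
      refine hcont.eventually_const_lt ?_
      have := hi₀ i
      simp only [Pi.zero_apply, neg_zero, zero_sub, neg_sq]
      linarith
    · set F : (Fin n → ℝ) → ℝ := fun x =>
        ∑ i, (if i ∈ S then Real.arccos (-x i - c i) else -Real.arccos (-x i - c i)) with hF
      have hcont : Continuous F := by
        refine continuous_finsetSum _ fun i _ => ?_
        split_ifs
        · exact Real.continuous_arccos.comp (by fun_prop)
        · exact (Real.continuous_arccos.comp (by fun_prop)).neg
      have hF0 : ∑ i, (if i ∈ S then Real.arccos (-c i) else -Real.arccos (-c i)) = F 0 := by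
        simp [hF]
      rw [hF0]
      -- Multiples of 2π are discrete: near such a multiple there is no other. If `F 0` is not a
      -- multiple, neither are nearby values, and these orientations do not occur.
      by_cases h : ∃ k : ℤ, F 0 = k * (2 * Real.pi)
      · obtain ⟨k₀, hk₀⟩ := h
        have h1 : ∀ᶠ x in 𝓝 0, dist (F x) (F 0) < 2 * Real.pi :=
          Metric.tendsto_nhds.1 hcont.continuousAt _ (by positivity)
        filter_upwards [h1] with x hx k hk
        change F x = _ at hk
        change F x = _
        rw [hk, hk₀, Real.dist_eq, ← sub_mul, abs_mul, abs_of_pos Real.two_pi_pos] at hx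
        have h2 : |((k - k₀ : ℤ) : ℝ)| < 1 := by
          push_cast
          by_contra hcon
          nlinarith [Real.two_pi_pos]
        have h3 : k - k₀ = 0 := Int.abs_lt_one_iff.1 (by exact_mod_cast h2)
        rw [hk, hk₀, sub_eq_zero.1 h3]
      · have h0 : Real.cos (F 0) ≠ 1 := fun h1 =>
          h ((Real.cos_eq_one_iff _).1 h1 |>.imp fun k hk => hk.symm)
        have h1 : ∀ᶠ x in 𝓝 0, Real.cos (F x) ≠ 1 :=
          (Real.continuous_cos.comp hcont).continuousAt.eventually_ne h0
        filter_upwards [h1] with x hx k hk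
        exact absurd ((Real.cos_eq_one_iff _).2 ⟨k, hk.symm⟩) hx
  obtain ⟨δ, hδ, hball⟩ := Metric.eventually_nhds_iff.1 hev
  refine ⟨m, Real.sqrt_pos.2 (by positivity), δ, hδ, fun x hx => ?_⟩
  have hx' : dist x 0 < δ := by
    rw [dist_zero_right]
    refine lt_of_le_of_lt ((pi_norm_le_iff_of_nonneg (Finset.sum_nonneg fun _ _ => abs_nonneg _)).2
      fun i => ?_) hx
    exact Finset.single_le_sum (f := fun i => |x i|) (fun _ _ => abs_nonneg _) (Finset.mem_univ i)
  exact ⟨fun i => ((hball hx').1 i).le, (hball hx').2⟩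

/-- If the signed angles at the perturbed and at the unperturbed cosines have the same sum, then
the perturbation has both signs relative to the orientation. -/
theorem exists_oriented_signs {n : ℕ} {c x : Fin n → ℝ} (hc : ∀ i, c i ^ 2 < 1)
    (hx : ∀ i, (-x i - c i) ^ 2 < 1) {S : Finset (Fin n)}
    (hsum : ∑ i, (if i ∈ S then Real.arccos (-x i - c i) else -Real.arccos (-x i - c i))
      = ∑ i, (if i ∈ S then Real.arccos (-c i) else -Real.arccos (-c i)))
    (hx0 : x ≠ 0) :
    (∃ i, if i ∈ S then 0 < x i else x i < 0) ∧ ∃ j, if j ∈ S then x j < 0 else 0 < x j := by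
  have hI : ∀ i, -c i ∈ Icc (-1 : ℝ) 1 := fun i => by
    have := abs_le_of_sq_le_sq (by linarith [hc i] : (-c i) ^ 2 ≤ 1 ^ 2) zero_le_one
    exact abs_le.1 (by simpa using this)
  have hIx : ∀ i, -x i - c i ∈ Icc (-1 : ℝ) 1 := fun i => by
    have := abs_le_of_sq_le_sq (by linarith [hx i] : (-x i - c i) ^ 2 ≤ 1 ^ 2) zero_le_one
    exact abs_le.1 this
  have hlt : ∀ i, Real.arccos (-c i) < Real.arccos (-x i - c i) ↔ 0 < x i := fun i => by
    rw [Real.strictAntiOn_arccos.lt_iff_gt (hI i) (hIx i)]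
    constructor <;> intro h <;> linarith
  have hlt' : ∀ i, Real.arccos (-x i - c i) < Real.arccos (-c i) ↔ x i < 0 := fun i => by
    rw [Real.strictAntiOn_arccos.lt_iff_gt (hIx i) (hI i)]
    constructor <;> intro h <;> linarith
  obtain ⟨k, hk⟩ := Function.ne_iff.1 hx0
  constructor
  · by_contra! hcon
    refine hsum.not_lt (Finset.sum_lt_sum (fun i _ => ?_) ⟨k, Finset.mem_univ k, ?_⟩)
    · have := hcon i; have h1 := hlt i; have h2 := hlt' i
      split_ifs at this ⊢ <;> grind
    · have := hcon k; have h1 := hlt k; have h2 := hlt' k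
      simp only [Pi.zero_apply] at hk
      split_ifs at this ⊢ <;> grind
  · by_contra! hcon
    refine hsum.not_gt (Finset.sum_lt_sum (fun i _ => ?_) ⟨k, Finset.mem_univ k, ?_⟩)
    · have := hcon i; have h1 := hlt i; have h2 := hlt' i
      split_ifs at this ⊢ <;> grind
    · have := hcon k; have h1 := hlt k; have h2 := hlt' k
      simp only [Pi.zero_apply] at hk
      split_ifs at this ⊢ <;> grind

/-- The cross product of two vectors of the plane. -/
def cross (u v : Plane) : ℝ := u 0 * v 1 - u 1 * v 0

theorem inner_plane (u v : Plane) : inner ℝ u v = u 0 * v 0 + u 1 * v 1 := by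
  simp [PiLp.inner_apply, Fin.sum_univ_two]; ring

theorem inner_sq_add_cross_sq (u v : Plane) :
    inner ℝ u v ^ 2 + cross u v ^ 2 = ‖u‖ ^ 2 * ‖v‖ ^ 2 := by
  rw [← real_inner_self_eq_norm_sq, ← real_inner_self_eq_norm_sq]
  simp only [inner_plane, cross]; ring

/-- The turns of a closed chain of unit vectors add up to a multiple of `2π`. -/
theorem exists_sum_turning_angle_eq {n : ℕ} [NeZero n] (g : Fin n → Plane) (hg : ∀ i, ‖g i‖ = 1) :
    ∃ k : ℤ, ∑ i, (if i ∈ Finset.univ.filter (fun i => 0 ≤ cross (g (i - 1)) (g i))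
        then Real.arccos (inner ℝ (g i) (g (i - 1)))
        else -Real.arccos (inner ℝ (g i) (g (i - 1)))) = k * (2 * Real.pi) := by
  let w : Fin n → ℂ := fun i => ⟨g i 0, g i 1⟩
  -- `q i` is the rotation taking `g (i - 1)` to `g i`; its argument is the signed turning angle,
  -- with π at a reversal. Around the cycle the rotations cancel.
  let q : Fin n → ℂ := fun i => (starRingEnd ℂ) (w (i - 1)) * w i
  have hw : ∀ i, ‖w i‖ = 1 := fun i => by
    have h1 : ‖w i‖ ^ 2 = ‖g i‖ ^ 2 := by
      rw [← Complex.normSq_eq_norm_sq, ← real_inner_self_eq_norm_sq, inner_plane,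
        Complex.normSq_apply]
    rw [hg i] at h1
    exact (sq_eq_sq₀ (norm_nonneg _) zero_le_one).1 h1
  have hq : ∀ i, ‖q i‖ = 1 := fun i => by simp [q, hw]
  have hre : ∀ i, (q i).re = inner ℝ (g i) (g (i - 1)) := fun i => by
    simp [q, w, inner_plane]; ring
  have him : ∀ i, (q i).im = cross (g (i - 1)) (g i) := fun i => by
    simp [q, w, cross]; ring
  have harg : ∀ i, (q i).arg = if i ∈ Finset.univ.filter (fun i => 0 ≤ cross (g (i - 1)) (g i))
        then Real.arccos (inner ℝ (g i) (g (i - 1)))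
        else -Real.arccos (inner ℝ (g i) (g (i - 1))) := fun i => by
    have hq0 : q i ≠ 0 := norm_ne_zero_iff.1 (by simp [hq])
    simp only [Finset.mem_filter_univ, ← him, ← hre]
    split_ifs with h
    · rw [Complex.arg_of_im_nonneg_of_ne_zero h hq0, hq, div_one]
    · rw [Complex.arg_of_im_neg (not_le.1 h), hq, div_one]
  have hprod : ∏ i, q i = 1 := by
    have hshift : ∏ i, (starRingEnd ℂ) (w (i - 1)) = ∏ i, (starRingEnd ℂ) (w i) :=
      Fintype.prod_equiv (Equiv.subRight 1) _ _ fun _ => rfl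
    rw [Finset.prod_mul_distrib, hshift, ← Finset.prod_mul_distrib]
    refine Finset.prod_eq_one fun i _ => ?_
    rw [← Complex.normSq_eq_conj_mul_self, Complex.normSq_eq_norm_sq, hw]
    simp
  have hexp : Complex.exp ((∑ i, (q i).arg : ℝ) * Complex.I) = 1 := by
    rw [← hprod, Complex.ofReal_sum, Finset.sum_mul, Complex.exp_sum]
    refine Finset.prod_congr rfl fun i _ => ?_
    have := Complex.norm_mul_exp_arg_mul_I (q i)
    rwa [hq, Complex.ofReal_one, one_mul] at this
  obtain ⟨k, hk⟩ := Complex.exp_eq_one_iff.1 hexp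
  refine ⟨k, ?_⟩
  rw [← Finset.sum_congr rfl fun i _ => harg i]
  have := congrArg Complex.im hk
  simpa using this

/-- Around a cycle the total variation is at least the difference of any two values. -/
theorem abs_sub_le_sum_cyclic {n : ℕ} [NeZero n] (b : Fin n → ℝ) (i j : Fin n) :
    |b i - b j| ≤ ∑ k, |b (k + 1) - b k| := by
  wlog hij : i ≤ j generalizing i j
  · rw [abs_sub_comm]; exact this j i (le_of_not_ge hij)
  -- The cycle is unrolled along ℕ; the path from `i` up to `j` does not wrap around.
  let f : ℕ → ℝ := fun k => b (Fin.ofNat n k)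
  have hf : ∀ k : Fin n, f k = b k := fun k => by simp [f]
  have h1 := dist_le_Ico_sum_dist f (Fin.le_def.1 hij)
  rw [hf, hf, Real.dist_eq] at h1
  refine h1.trans ?_
  have h2 : ∑ k : Fin n, |b (k + 1) - b k| = ∑ k ∈ Finset.range n, dist (f k) (f (k + 1)) := by
    rw [← Fin.sum_univ_eq_sum_range (fun k => dist (f k) (f (k + 1)))]
    refine Finset.sum_congr rfl fun k _ => ?_
    rw [hf, Real.dist_eq, abs_sub_comm]
    congr 3
    ext
    simp [Fin.ofNat, Fin.val_add]
  rw [h2]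
  refine Finset.sum_le_sum_of_subset_of_nonneg (fun k hk => ?_) fun _ _ _ => dist_nonneg
  have := j.isLt
  simp only [Finset.mem_Ico, Finset.mem_range] at hk ⊢
  omega


/-! ### Filippov sets. -/

/-- A closed convex set that `f` attains near `x`, up to arbitrarily small perturbations of an
image under a continuous linear map, contains the image of the Filippov set. -/
theorem map_mem_of_mem_filippov {E F : Type*} [NormedAddCommGroup E] [NormedSpace ℝ E]
    [MeasureSpace E] [NormedAddCommGroup F] [NormedSpace ℝ F] {f : E → E} {x v : E}
    (hv : v ∈ filippov f x) (A : E →L[ℝ] F) {K : Set F} (hK : Convex ℝ K) (hKc : IsClosed K)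
    (h : ∀ δ > 0, ∀ᶠ y in 𝓝 x, A (f y) ∈ Metric.cthickening δ K) : A v ∈ K := by
  rw [← hKc.closure_eq, Metric.closure_eq_iInter_cthickening]
  refine mem_iInter₂.2 fun δ hδ => ?_
  obtain ⟨r, hr, hball⟩ := Metric.eventually_nhds_iff_ball.1 (h δ hδ)
  have h1 := mem_iInter.1 (mem_iInter.1 hv ⟨r, hr⟩) ⟨∅, measure_empty⟩
  refine (closure_minimal (convexHull_min ?_ ((hK.cthickening δ).linear_preimage A.toLinearMap))
    (Metric.isClosed_cthickening.preimage A.continuous)) h1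
  rintro _ ⟨y, hy, rfl⟩
  exact hball y hy.1

theorem map_mem_filippov {E : Type*} [NormedAddCommGroup E] [NormedSpace ℝ E] [MeasureSpace E]
    {f : E → E} {x v : E} (hv : v ∈ filippov f x) (A : E →L[ℝ] E) :
    A v ∈ filippov (fun y => A (f y)) x := by
  refine mem_iInter.2 fun r => mem_iInter.2 fun S => ?_
  have h1 := mem_iInter.1 (mem_iInter.1 hv r) S
  have h2 := image_closure_subset_closure_image A.continuous (mem_image_of_mem A h1)
  have h3 := A.toLinearMap.image_convexHull (f '' (Metric.ball x r.1 \ S.1))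
  change A '' _ = convexHull ℝ (A '' _) at h3
  rw [h3, image_image] at h2
  exact h2

theorem mem_filippov_sgn_iff {n : ℕ} {x η : Fin n → ℝ} :
    η ∈ filippov sgn x ↔ ∀ i, |η i| ≤ 1 ∧ (x i ≠ 0 → η i = Real.sign (x i)) := by
  constructor
  · intro h i
    constructor
    · have h1 := map_mem_of_mem_filippov h (ContinuousLinearMap.proj i) (K := Icc (-1) 1)
        (convex_Icc _ _) isClosed_Icc fun δ hδ => Eventually.of_forall fun y =>
          Metric.self_subset_cthickening _ ?_
      · exact abs_le.2 h1
      · rcases Real.sign_apply_eq (y i) with h | h | h <;> simp [sgn, h]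
    · intro hi
      refine map_mem_of_mem_filippov h (ContinuousLinearMap.proj i) (K := {Real.sign (x i)})
        (convex_singleton _) isClosed_singleton fun δ hδ => ?_
      have hcont : ContinuousAt (fun y : Fin n → ℝ => y i) x :=
        (continuous_apply i).continuousAt
      rcases hi.lt_or_gt with hi | hi
      · filter_upwards [hcont.eventually_lt_const hi] with y hy
        refine Metric.self_subset_cthickening _ ?_
        simp [sgn, Real.sign_of_neg hi, Real.sign_of_neg hy]
      · filter_upwards [hcont.eventually_const_lt hi] with y hy
        refine Metric.self_subset_cthickening _ ?_
        simp [sgn, Real.sign_of_pos hi, Real.sign_of_pos hy]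
  · intro h
    refine mem_iInter.2 fun ⟨r, hr⟩ => mem_iInter.2 fun ⟨S, hS⟩ => subset_closure ?_
    -- The candidates for `η` form a box, the convex hull of its vertices. It suffices that each
    -- vertex is a value of `sgn` near `x` off any null set.
    let P : Fin n → Set ℝ := fun i => if x i = 0 then {-1, 1} else {Real.sign (x i)}
    have hη : η ∈ convexHull ℝ (univ.pi P) := by
      rw [convexHull_pi]
      intro i _
      by_cases hi : x i = 0
      · simp only [P, hi, if_true, convexHull_pair]
        rw [segment_eq_Icc (by norm_num)]
        exact abs_le.1 (h i).1
      · simp [P, hi, (h i).2 hi]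
    refine convexHull_mono ?_ hη
    intro τ hτ
    have hτ1 : ∀ i, (τ i = 1 ∨ τ i = -1) ∧ 0 ≤ τ i * x i := fun i => by
      have := hτ i (mem_univ i)
      by_cases hi : x i = 0
      · simp only [P, hi, if_true, mem_insert_iff, mem_singleton_iff] at this
        simp [hi, this.symm]
      · simp only [P, hi, if_false, mem_singleton_iff] at this
        rw [this]
        exact ⟨(Real.sign_apply_eq_of_ne_zero _ hi).symm,
          Real.sign_mul_nonneg _⟩
    -- On this open part of the ball `sgn` equals `τ`. It is nonempty, since `x` can be shifted
    -- along `τ`, so a null set cannot cover it.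
    let U : Set (Fin n → ℝ) := Metric.ball x r ∩ {y | ∀ i, 0 < τ i * y i}
    have hU : IsOpen U := by
      refine Metric.isOpen_ball.inter ?_
      rw [ofPred_forall]
      exact isOpen_iInter_of_finite fun i => isOpen_lt continuous_const (by fun_prop)
    have hne : U.Nonempty := by
      refine ⟨fun i => x i + (r / 2) * τ i, ?_, fun i => ?_⟩
      · rw [Metric.mem_ball, dist_pi_lt_iff hr]
        intro i
        rw [Real.dist_eq]
        rcases (hτ1 i).1 with h | h <;> rw [h] <;>
          simp only [add_sub_cancel_left, mul_one, mul_neg, abs_neg] <;>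
          rw [abs_of_pos (by positivity)] <;> linarith
      · have h2 : τ i * τ i = 1 := by rcases (hτ1 i).1 with h | h <;> rw [h] <;> norm_num
        nlinarith [(hτ1 i).2]
    have hpos := hU.measure_pos volume hne
    obtain ⟨y, hy, hyS⟩ : ∃ y ∈ U, y ∉ S := by
      by_contra! hcon
      exact hpos.ne' (measure_mono_null hcon hS)
    refine ⟨y, ⟨hy.1, hyS⟩, funext fun i => ?_⟩
    have h2 := hy.2 i
    rcases (hτ1 i).1 with h | h <;> rw [h] at h2 ⊢
    · exact Real.sign_of_pos (by linarith)
    · exact Real.sign_of_neg (by linarith)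


/-! ### Bearings, errors and the regularised closed loop. -/

theorem abs_sgn_le {n : ℕ} (x : Fin n → ℝ) (i : Fin n) : |sgn x i| ≤ 1 := by
  rcases Real.sign_apply_eq (x i) with h | h | h <;> simp [sgn, h]

theorem abs_le_V {n : ℕ} (x : Fin n → ℝ) (i : Fin n) : |x i| ≤ V x :=
  Finset.single_le_sum (f := fun i => |x i|) (fun _ _ => abs_nonneg _) (Finset.mem_univ i)

theorem V_nonneg {n : ℕ} (x : Fin n → ℝ) : 0 ≤ V x := Finset.sum_nonneg fun _ _ => abs_nonneg _

theorem eq_zero_of_V_le_zero {n : ℕ} {x : Fin n → ℝ} (h : V x ≤ 0) : x = 0 :=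
  funext fun i => abs_nonpos_iff.1 ((abs_le_V x i).trans h)

theorem four_mul_collisionTime_le {n : ℕ} (z : Config n) {i j : Fin n} (h : i ≠ j) :
    4 * collisionTime z ≤ ‖z i - z j‖ := by
  have h1 := ciInf_le (Finite.bddBelow_range fun p : {p : Fin n × Fin n // p.1 ≠ p.2} =>
    ‖z p.1.1 - z p.1.2‖) ⟨(i, j), h⟩
  rw [collisionTime]
  simp only at h1
  linarith

variable {n : ℕ} [NeZero n]

theorem norm_bearing {z : Config n} {i : Fin n} (h : edge z i ≠ 0) : ‖bearing z i‖ = 1 :=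
  norm_smul_inv_norm (𝕜 := ℝ) h

theorem norm_bearing_le (z : Config n) (i : Fin n) : ‖bearing z i‖ ≤ 1 := by
  rcases eq_or_ne (edge z i) 0 with h | h
  · simp [bearing, h]
  · exact (norm_bearing h).le

theorem norm_smul_bearing_sub_le {c : ℝ} (hc : |c| ≤ 1) (z : Config n) (i j : Fin n) :
    ‖c • (bearing z i - bearing z j)‖ ≤ 2 := by
  rw [norm_smul, Real.norm_eq_abs]
  have h := norm_sub_le_of_le (norm_bearing_le z i) (norm_bearing_le z j)
  nlinarith [norm_nonneg (bearing z i - bearing z j), abs_nonneg c]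

theorem continuousAt_bearing {z : Config n} {i : Fin n} (h : edge z i ≠ 0) :
    ContinuousAt (fun w => bearing w i) z := by
  have he : Continuous fun w : Config n => edge w i :=
    (continuous_apply (i + 1)).sub (continuous_apply i)
  exact (he.norm.continuousAt.inv₀ (norm_ne_zero_iff.2 h)).smul he.continuousAt

theorem continuousAt_angleError (θs : Fin n → ℝ) {z : Config n} (h : ∀ i, edge z i ≠ 0)
    (i : Fin n) : ContinuousAt (fun w => angleError θs w i) z :=
  (((continuousAt_bearing (h i)).inner (𝕜 := ℝ) (continuousAt_bearing (h (i - 1)))).neg).sub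
    continuousAt_const

/-- Valid at collisions too, which keeps the collision-avoidance argument from being circular. -/
theorem norm_le_of_mem_filippov_closedLoop {θs : Fin n → ℝ} {z v : Config n}
    (hv : v ∈ filippov (closedLoop θs) z) (i : Fin n) : ‖v i‖ ≤ 2 := by
  have h := map_mem_of_mem_filippov hv (ContinuousLinearMap.proj i) (K := Metric.closedBall 0 2)
    (convex_closedBall _ _) Metric.isClosed_closedBall fun δ hδ => Eventually.of_forall fun y =>
      Metric.self_subset_cthickening _ (mem_closedBall_zero_iff.2
        (norm_smul_bearing_sub_le (abs_sgn_le _ _) _ _ _))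
  exact mem_closedBall_zero_iff.1 h

/-- Away from collisions, the Filippov set of the closed loop only regularises the signs. -/
theorem exists_sgn_of_mem_filippov_closedLoop {θs : Fin n → ℝ} {z v : Config n}
    (hz : ∀ i, edge z i ≠ 0) (hv : v ∈ filippov (closedLoop θs) z) :
    ∃ η ∈ filippov sgn (angleError θs z),
      v = fun i => η i • (bearing z i - bearing z (i - 1)) := by
  have key : ∀ i, ∃ c : ℝ, (|c| ≤ 1 ∧ (angleError θs z i ≠ 0 → c = Real.sign (angleError θs z i)))
      ∧ c • (bearing z i - bearing z (i - 1)) = v i := by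
    intro i
    set u : Config n → Plane := fun w => bearing w i - bearing w (i - 1) with hu
    let J : Set ℝ := if angleError θs z i = 0 then Icc (-1) 1 else {Real.sign (angleError θs z i)}
    have hJ : ∀ c, c ∈ J ↔
        |c| ≤ 1 ∧ (angleError θs z i ≠ 0 → c = Real.sign (angleError θs z i)) := by
      intro c
      by_cases h : angleError θs z i = 0
      · simp [J, h, abs_le]
      · simp only [J, h, if_false, mem_singleton_iff, ne_eq, not_false_eq_true, true_implies]
        refine ⟨fun hc => ⟨hc ▸ abs_sgn_le (angleError θs z) i, hc⟩, fun hc => hc.2⟩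
    have hJconv : Convex ℝ J := by
      dsimp only [J]; split_ifs
      · exact convex_Icc _ _
      · exact convex_singleton _
    have hJcomp : IsCompact J := by
      dsimp only [J]; split_ifs
      · exact isCompact_Icc
      · exact isCompact_singleton
    have hev : ∀ᶠ w in 𝓝 z, sgn (angleError θs w) i ∈ J := by
      have hcont := continuousAt_angleError θs hz i
      simp only [hJ, abs_sgn_le, true_and]
      rcases lt_trichotomy (angleError θs z i) 0 with h | h | h
      · filter_upwards [hcont.eventually_lt_const h] with w hw _
        simp [sgn, Real.sign_of_neg h, Real.sign_of_neg hw]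
      · simp [h]
      · filter_upwards [hcont.eventually_const_lt h] with w hw _
        simp [sgn, Real.sign_of_pos h, Real.sign_of_pos hw]
    have hcontu : ContinuousAt u z :=
      (continuousAt_bearing (hz i)).sub (continuousAt_bearing (hz (i - 1)))
    -- Near `z` the field is an admissible sign times `u w`, hence within `δ` of the fixed compact
    -- convex set of multiples of `u z`.
    have hmem : v i ∈ (fun c : ℝ => c • u z) '' J := by
      refine map_mem_of_mem_filippov hv (ContinuousLinearMap.proj i)
        (hJconv.linear_image (LinearMap.toSpanSingleton ℝ Plane (u z)))
        (hJcomp.image (by fun_prop)).isClosed fun δ hδ => ?_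
      filter_upwards [hev, Metric.tendsto_nhds.1 hcontu δ hδ] with w hw hd
      refine Metric.mem_cthickening_of_dist_le _ (sgn (angleError θs w) i • u z) _ _
        (mem_image_of_mem _ hw) ?_
      change dist (sgn (angleError θs w) i • u w) _ ≤ _
      rw [dist_eq_norm, ← smul_sub, norm_smul, ← dist_eq_norm]
      have := abs_sgn_le (angleError θs w) i
      rw [Real.norm_eq_abs]
      nlinarith [dist_nonneg (x := u w) (y := u z), abs_nonneg (sgn (angleError θs w) i)]
    obtain ⟨c, hc, hcv⟩ := hmem
    exact ⟨c, (hJ c).1 hc, hcv⟩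
  choose η hη hv' using key
  exact ⟨η, mem_filippov_sgn_iff.2 hη, funext fun i => (hv' i).symm⟩

/-! ### The error system and its quadratic form. -/

theorem proj_add (z : Config n) (i : Fin n) (x y : Plane) :
    proj z i (x + y) = proj z i x + proj z i y := by
  simp only [proj, inner_add_right, add_smul]; abel

theorem proj_smul (z : Config n) (i : Fin n) (c : ℝ) (x : Plane) :
    proj z i (c • x) = c • proj z i x := by
  simp only [proj, inner_smul_right, smul_sub, mul_smul]

theorem proj_bearing {z : Config n} {i : Fin n} (h : edge z i ≠ 0) :
    proj z i (bearing z i) = 0 := by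
  simp [proj, norm_bearing h]

theorem inner_proj {z : Config n} {i : Fin n} (h : edge z i ≠ 0) (x : Plane) :
    inner ℝ x (proj z i x) = cross (bearing z i) x ^ 2 := by
  have h1 := inner_sq_add_cross_sq (bearing z i) x
  rw [norm_bearing h, one_pow, one_mul, ← real_inner_self_eq_norm_sq] at h1
  rw [proj, inner_sub_right, inner_smul_right, real_inner_comm (bearing z i) x]
  linarith

theorem hasDerivAt_bearing {z : ℝ → Config n} {v : Config n} {s : ℝ} (hz : HasDerivAt z v s)
    {i : Fin n} (h : edge (z s) i ≠ 0) :
    HasDerivAt (fun t => bearing (z t) i)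
      (‖edge (z s) i‖⁻¹ • proj (z s) i (v (i + 1) - v i)) s := by
  have he : HasDerivAt (fun t => edge (z t) i) (v (i + 1) - v i) s :=
    (hasDerivAt_pi.1 hz (i + 1)).sub (hasDerivAt_pi.1 hz i)
  have hpos : 0 < ‖edge (z s) i‖ := norm_pos_iff.2 h
  have hn : HasDerivAt (fun t => ‖edge (z t) i‖)
      (inner ℝ (bearing (z s) i) (v (i + 1) - v i)) s := by
    have h1 := he.norm_sq.sqrt (by positivity)
    simp only [Real.sqrt_sq (norm_nonneg _)] at h1
    refine h1.congr_deriv ?_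
    rw [bearing, real_inner_smul_left]
    field_simp
  refine ((hn.inv hpos.ne').smul he).congr_deriv ?_
  simp only [proj, bearing, smul_sub, smul_smul, inner_smul_left, Pi.inv_apply]
  rw [sub_eq_add_neg, ← neg_smul]
  simp
  field_simp
  rw [neg_smul]
  abel

/-- The component of the edge velocity across the edge, for the signs `η`. -/
noncomputable def edgeDrive (z : Config n) (η : Fin n → ℝ) (i : Fin n) : Plane :=
  η (i + 1) • bearing z (i + 1) + η i • bearing z (i - 1)

theorem add_one_ne_self (hn : 3 ≤ n) (i : Fin n) : i + 1 ≠ i := by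
  have : Fact (1 < n) := ⟨by omega⟩
  obtain ⟨m, rfl⟩ : ∃ m, n = m + 2 := ⟨n - 2, by omega⟩
  simp

theorem add_two_ne_self (hn : 3 ≤ n) (i : Fin n) : i + 1 ≠ i - 1 := by
  obtain ⟨m, rfl⟩ : ∃ m, n = m + 3 := ⟨n - 3, by omega⟩
  intro h
  have h1 : i + (1 + 1) = i + 0 := by
    rw [add_zero, ← add_assoc, h, sub_add_cancel]
  have h2 := congrArg Fin.val (add_left_cancel h1)
  rw [Fin.val_add, Fin.val_one, Fin.val_zero, Nat.mod_eq_of_lt (by omega)] at h2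
  omega

/-- Regrouping the row by the two edges at vehicle `i`. The three nonzero entries sit at distinct
indices only because `3 ≤ n`. -/
theorem errorMatrix_mulVec (hn : 3 ≤ n) (z : Config n) (η : Fin n → ℝ) (i : Fin n) :
    (errorMatrix z *ᵥ η) i =
      ‖edge z (i - 1)‖⁻¹ * inner ℝ (bearing z i) (proj z (i - 1) (edgeDrive z η (i - 1)))
      + ‖edge z i‖⁻¹ * inner ℝ (bearing z (i - 1)) (proj z i (edgeDrive z η i)) := by
  have h1 : i - 1 ≠ i := fun h => add_one_ne_self hn (i - 1) (by rw [sub_add_cancel, h])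
  have h2 := add_one_ne_self hn i
  have h3 := add_two_ne_self hn i
  rw [Matrix.mulVec, dotProduct,
    ← Finset.sum_subset (Finset.subset_univ {i - 1, i, i + 1}) (fun j _ hj => by
      simp only [Finset.mem_insert, Finset.mem_singleton, not_or] at hj
      simp [errorMatrix, hj.1, hj.2.1, hj.2.2])]
  rw [Finset.sum_insert (by simp [h1, h3.symm]), Finset.sum_insert (by simp [h2.symm]),
    Finset.sum_singleton]
  simp only [errorMatrix, Matrix.of_apply, if_true, h1.symm, h2, h3, if_false, edgeDrive,
    proj_add, proj_smul, inner_add_right, inner_smul_right, sub_add_cancel]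
  ring

/-- The derivative of the errors along `ż_i = η_i (g_i - g_{i-1})` is `-A η`. -/
theorem hasDerivAt_angleError (hn : 3 ≤ n) (θs : Fin n → ℝ) {z : ℝ → Config n} {η : Fin n → ℝ}
    {s : ℝ} (hedge : ∀ i, edge (z s) i ≠ 0)
    (hz : HasDerivAt z (fun i => η i • (bearing (z s) i - bearing (z s) (i - 1))) s) :
    HasDerivAt (fun t => angleError θs (z t)) (-(errorMatrix (z s) *ᵥ η)) s := by
  -- The relative velocity differs from the edge drive by a multiple of `g_i`, which the projection
  -- kills.
  have hproj : ∀ i : Fin n, proj (z s) i (η (i + 1) • (bearing (z s) (i + 1) -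
      bearing (z s) (i + 1 - 1)) - η i • (bearing (z s) i - bearing (z s) (i - 1)))
      = proj (z s) i (edgeDrive (z s) η i) := by
    intro i
    have : η (i + 1) • (bearing (z s) (i + 1) - bearing (z s) (i + 1 - 1))
        - η i • (bearing (z s) i - bearing (z s) (i - 1))
        = edgeDrive (z s) η i + (-(η (i + 1) + η i)) • bearing (z s) i := by
      rw [edgeDrive, add_sub_cancel_right]; module
    rw [this, proj_add, proj_smul, proj_bearing (hedge i), smul_zero, add_zero]
  refine hasDerivAt_pi.2 fun i => ?_
  have h1 := hasDerivAt_bearing hz (hedge i)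
  have h2 := hasDerivAt_bearing hz (hedge (i - 1))
  rw [hproj] at h1 h2
  refine (((h1.inner ℝ h2).neg).sub_const (Real.cos (θs i))).congr_deriv ?_
  rw [Pi.neg_apply, errorMatrix_mulVec hn, inner_smul_left, inner_smul_right,
    real_inner_comm (bearing (z s) (i - 1))]
  simp

/-- The sine of the turning angle at vehicle `i`. -/
noncomputable def turn (z : Config n) (i : Fin n) : ℝ := cross (bearing z (i - 1)) (bearing z i)

/-- After a cyclic shift the two terms belonging to edge `i` combine into uᵀP_i u with u the edge
drive, and in the plane this is the square of the cross product with `g_i`. -/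
theorem sum_mul_errorMatrix_mulVec (hn : 3 ≤ n) {z : Config n} (hz : ∀ i, edge z i ≠ 0)
    (η : Fin n → ℝ) :
    ∑ i, η i * (errorMatrix z *ᵥ η) i =
      ∑ i, (η (i + 1) * turn z (i + 1) - η i * turn z i) ^ 2 / ‖edge z i‖ := by
  simp only [errorMatrix_mulVec hn, mul_add, Finset.sum_add_distrib]
  rw [← Fintype.sum_equiv (Equiv.addRight (1 : Fin n)) (fun i => η (i + 1) * (‖edge z i‖⁻¹ *
    inner ℝ (bearing z (i + 1)) (proj z i (edgeDrive z η i)))) _ (fun i => by simp),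
    ← Finset.sum_add_distrib]
  refine Finset.sum_congr rfl fun i _ => ?_
  have h1 := inner_proj (hz i) (edgeDrive z η i)
  have h2 : inner ℝ (edgeDrive z η i) (proj z i (edgeDrive z η i))
      = η (i + 1) * inner ℝ (bearing z (i + 1)) (proj z i (edgeDrive z η i))
        + η i * inner ℝ (bearing z (i - 1)) (proj z i (edgeDrive z η i)) := by
    nth_rw 1 [edgeDrive]
    rw [inner_add_left, real_inner_smul_left, real_inner_smul_left]
  have h3 : cross (bearing z i) (edgeDrive z η i)
      = η (i + 1) * turn z (i + 1) - η i * turn z i := by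
    simp [edgeDrive, turn, cross]; ring
  rw [← h3, ← h1, h2]
  ring

/-- The values η_k s_k differ by at least `2 * m` somewhere, so their cyclic variation is at least
that; Cauchy–Schwarz with weights ‖e_k‖ does the rest. -/
theorem dissipation_lower_bound {z : Config n} (hz : ∀ i, edge z i ≠ 0) {η : Fin n → ℝ} {m P : ℝ}
    (hm : 0 ≤ m) (hP : ∑ i, ‖edge z i‖ ≤ P) {i j : Fin n} (hi : m ≤ η i * turn z i)
    (hj : η j * turn z j ≤ -m) :
    (2 * m) ^ 2 / P ≤ ∑ i, (η (i + 1) * turn z (i + 1) - η i * turn z i) ^ 2 / ‖edge z i‖ := by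
  have hpos : 0 < ∑ i, ‖edge z i‖ :=
    Finset.sum_pos (fun i _ => norm_pos_iff.2 (hz i)) Finset.univ_nonempty
  have h1 := abs_sub_le_sum_cyclic (fun k => η k * turn z k) i j
  have h2 := (le_abs_self _).trans h1
  have h3 := Finset.sq_sum_div_le_sum_sq_div Finset.univ
    (fun k => |η (k + 1) * turn z (k + 1) - η k * turn z k|) (g := fun k => ‖edge z k‖)
    fun k _ => norm_pos_iff.2 (hz k)
  simp only [sq_abs] at h3
  refine le_trans ?_ h3
  gcongr
  linarith

theorem absolutelyContinuousOnInterval_angleError (θs : Fin n → ℝ) {z : ℝ → Config n} {a b : ℝ}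
    (hz : AbsolutelyContinuousOnInterval z a b) (hedge : ∀ t ∈ uIcc a b, ∀ i, edge (z t) i ≠ 0) :
    AbsolutelyContinuousOnInterval (fun t => angleError θs (z t)) a b := by
  have he : ∀ i, AbsolutelyContinuousOnInterval (fun t => edge (z t) i) a b := fun i =>
    (hz.apply (i + 1)).sub (hz.apply i)
  have hg : ∀ i, AbsolutelyContinuousOnInterval (fun t => bearing (z t) i) a b := fun i =>
    ((he i).norm.inv fun t ht => norm_pos_iff.2 (hedge t ht i)).smul (he i)
  refine AbsolutelyContinuousOnInterval.pi fun i => ?_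
  refine ((hg i).real_inner (hg (i - 1))).of_dist_le 1 fun x _ y _ => ?_
  simp only [angleError, dist_sub_right, dist_neg_neg, one_mul, le_refl]


/-! ### Uniform dissipation near ε = 0. -/

theorem edge_ne_zero (hn : 3 ≤ n) {z : Config n} (hz : NoCollision z) (i : Fin n) :
    edge z i ≠ 0 :=
  sub_ne_zero.2 (hz _ _ (add_one_ne_self hn i))

theorem exists_dissipation_rate (hn : 3 ≤ n) (θs : Fin n → ℝ)
    (hθ : ∀ i, Real.cos (θs i) ^ 2 < 1) :
    ∃ m > 0, ∃ δ > 0, ∀ z : Config n, (∀ i, edge z i ≠ 0) → V (angleError θs z) < δ →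
      angleError θs z ≠ 0 → ∀ η ∈ filippov sgn (angleError θs z), ∀ P : ℝ,
        ∑ i, ‖edge z i‖ ≤ P → (2 * m) ^ 2 / P ≤ ∑ i, η i * (errorMatrix z *ᵥ η) i := by
  obtain ⟨m, hm, δ, hδ, h⟩ := exists_signed_arccos_sum_eq (fun i => Real.cos (θs i)) hθ
  refine ⟨m, hm, δ, hδ, fun z hz hV h0 η hη P hP => ?_⟩
  obtain ⟨hturn, hsum⟩ := h _ hV
  have hcos : ∀ i, -angleError θs z i - Real.cos (θs i)
      = inner ℝ (bearing z i) (bearing z (i - 1)) := fun i => by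
    simp [angleError]
  have hsq : ∀ i, m ^ 2 ≤ turn z i ^ 2 := fun i => by
    have h1 := hturn i
    have h2 := inner_sq_add_cross_sq (bearing z (i - 1)) (bearing z i)
    rw [norm_bearing (hz _), norm_bearing (hz _), real_inner_comm] at h2
    rw [hcos] at h1
    change m ^ 2 ≤ cross _ _ ^ 2
    linarith
  have habs : ∀ i, m ≤ |turn z i| := fun i => by
    simpa [abs_of_pos hm] using sq_le_sq.1 (hsq i)
  obtain ⟨k, hk⟩ := exists_sum_turning_angle_eq (bearing z) fun i => norm_bearing (hz i)
  -- The orientation set is that of the actual polygon, so its angle sum is a multiple of 2π.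
  have heq := hsum (Finset.univ.filter fun i => 0 ≤ turn z i) k (by simp only [hcos]; exact hk)
  obtain ⟨⟨i, hi⟩, j, hj⟩ := exists_oriented_signs hθ
    (fun i => by have := hturn i; nlinarith) heq h0
  have hη' := mem_filippov_sgn_iff.1 hη
  rw [sum_mul_errorMatrix_mulVec hn hz]
  refine dissipation_lower_bound hz hm.le hP (i := i) (j := j) ?_ ?_
  · have h1 := habs i
    simp only [Finset.mem_filter_univ] at hi
    split_ifs at hi with ht
    · rw [(hη' i).2 hi.ne', Real.sign_of_pos hi, one_mul]
      rwa [abs_of_nonneg ht] at h1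
    · rw [(hη' i).2 hi.ne, Real.sign_of_neg hi]
      rw [abs_of_neg (not_le.1 ht)] at h1
      linarith
  · have h1 := habs j
    simp only [Finset.mem_filter_univ] at hj
    split_ifs at hj with ht
    · rw [(hη' j).2 hj.ne, Real.sign_of_neg hj]
      rw [abs_of_nonneg ht] at h1
      linarith
    · rw [(hη' j).2 hj.ne', Real.sign_of_pos hj, one_mul]
      rw [abs_of_neg (not_le.1 ht)] at h1
      linarith

/-! ### Estimates along motions. -/

/-- What the two notions of solution have in common. -/
def IsMotion (θs : Fin n → ℝ) (z : ℝ → Config n) (T : ℝ) : Prop :=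
  AbsolutelyContinuousOnInterval z 0 T ∧
    ∀ᵐ t ∂(volume.restrict (Icc 0 T)), ∃ v : Config n, HasDerivAt z v t ∧ (∀ i, ‖v i‖ ≤ 2) ∧
      ((∀ i, edge (z t) i ≠ 0) → ∃ η ∈ filippov sgn (angleError θs (z t)),
        v = fun i => η i • (bearing (z t) i - bearing (z t) (i - 1)))

theorem isMotion_of_solution {θs : Fin n → ℝ} {z : ℝ → Config n} {T : ℝ}
    (h : IsFilippovSolution (fun _ => closedLoop θs) z T ∨ IsSignInclusionSolution θs z T) :
    IsMotion θs z T := by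
  rcases h with h | h
  · refine ⟨h.1, ?_⟩
    filter_upwards [h.2] with t ⟨v, hv, hd⟩
    exact ⟨v, hd, norm_le_of_mem_filippov_closedLoop hv,
      fun hz => exists_sgn_of_mem_filippov_closedLoop hz hv⟩
  · refine ⟨h.1, ?_⟩
    filter_upwards [h.2] with t ⟨η, hη, hd⟩
    exact ⟨_, hd, fun i => norm_smul_bearing_sub_le (mem_filippov_sgn_iff.1 hη i).1 _ _ _,
      fun _ => ⟨η, hη, rfl⟩⟩

namespace IsMotion

variable {θs : Fin n → ℝ} {z : ℝ → Config n} {T : ℝ}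

theorem mono (h : IsMotion θs z T) {t : ℝ} (ht : t ∈ Icc 0 T) : IsMotion θs z t := by
  refine ⟨h.1.mono ?_, ae_restrict_of_ae_restrict_of_subset (Icc_subset_Icc_right ht.2) h.2⟩
  rw [uIcc_of_le ht.1, uIcc_of_le (ht.1.trans ht.2)]
  exact Icc_subset_Icc_right ht.2

theorem norm_sub_le (h : IsMotion θs z T) (hT : 0 ≤ T) (i : Fin n) :
    ‖z T i - z 0 i‖ ≤ 2 * T := by
  have := (h.1.apply i).norm_sub_le_of_ae_hasDerivAt (C := 2) hT (by
    filter_upwards [h.2] with t ⟨v, hd, hv, _⟩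
    exact ⟨v i, hv i, hasDerivAt_pi.1 hd i⟩)
  simpa using this

theorem noCollision (h : IsMotion θs z T) (hT : 0 ≤ T) (hlt : T < collisionTime (z 0)) :
    NoCollision (z T) := by
  intro i j hij heq
  have h1 := h.norm_sub_le hT i
  have h2 := h.norm_sub_le hT j
  have h3 := four_mul_collisionTime_le (z 0) hij
  have h4 : z 0 i - z 0 j = (z T j - z 0 j) - (z T i - z 0 i) := by rw [heq]; abel
  have h5 := _root_.norm_sub_le (z T j - z 0 j) (z T i - z 0 i)
  rw [← h4] at h5
  linarith

/-- Two endpoints of speed at most 2 lengthen an edge by at most 4T, which is no more than its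
initial length. -/
theorem perimeter_le (hn : 3 ≤ n) (h : IsMotion θs z T) (hT : 0 ≤ T)
    (hlt : T ≤ collisionTime (z 0)) :
    ∑ i, ‖edge (z T) i‖ ≤ 2 * ∑ i, ‖edge (z 0) i‖ := by
  rw [Finset.mul_sum]
  refine Finset.sum_le_sum fun i _ => ?_
  have h1 := h.norm_sub_le hT i
  have h2 := h.norm_sub_le hT (i + 1)
  have h3 := four_mul_collisionTime_le (z 0) (add_one_ne_self hn i)
  have h4 : edge (z T) i = edge (z 0) i + ((z T (i + 1) - z 0 (i + 1)) - (z T i - z 0 i)) := by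
    simp only [edge]; abel
  have h5 := _root_.norm_sub_le (z T (i + 1) - z 0 (i + 1)) (z T i - z 0 i)
  have h6 := norm_add_le (edge (z 0) i) ((z T (i + 1) - z 0 (i + 1)) - (z T i - z 0 i))
  rw [← h4] at h6
  change _ ≤ ‖edge (z 0) i‖ at h3
  linarith

theorem isFilippovSolution_angleError (hn : 3 ≤ n) (h : IsMotion θs z T) (hT : 0 ≤ T)
    (hz : ∀ s ∈ Icc 0 T, ∀ i, edge (z s) i ≠ 0) :
    IsFilippovSolution (errorField z) (fun s => angleError θs (z s)) T := by
  refine ⟨absolutelyContinuousOnInterval_angleError θs h.1 (by rwa [uIcc_of_le hT]), ?_⟩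
  filter_upwards [h.2, ae_restrict_mem measurableSet_Icc] with s ⟨v, hd, _, hsgn⟩ hs
  obtain ⟨η, hη, rfl⟩ := hsgn (hz s hs)
  refine ⟨_, ?_, hasDerivAt_angleError hn θs (hz s hs) hd⟩
  exact map_mem_filippov hη (LinearMap.toContinuousLinearMap (-(errorMatrix (z s)).mulVecLin))

theorem absolutelyContinuousOnInterval_V (h : IsMotion θs z T) (hT : 0 ≤ T)
    (hz : ∀ s ∈ Icc 0 T, ∀ i, edge (z s) i ≠ 0) :
    AbsolutelyContinuousOnInterval (fun s => V (angleError θs (z s))) 0 T := by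
  have hε := absolutelyContinuousOnInterval_angleError θs h.1 (by rwa [uIcc_of_le hT])
  refine AbsolutelyContinuousOnInterval.of_dist_le_sum (s := Finset.univ)
    (f := fun i s => |angleError θs (z s) i|) (fun _ => 1)
    (fun i _ => (hε.apply i).norm) fun x _ y _ => ?_
  simp only [one_mul]
  exact dist_sum_sum_le _ _ _

theorem ae_deriv_V (hn : 3 ≤ n) (h : IsMotion θs z T) (hT : 0 ≤ T)
    (hz : ∀ s ∈ Icc 0 T, ∀ i, edge (z s) i ≠ 0) :
    ∀ᵐ s ∂(volume.restrict (Icc 0 T)), ∃ η ∈ filippov sgn (angleError θs (z s)),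
      deriv (fun s => V (angleError θs (z s))) s = -∑ i, η i * (errorMatrix (z s) *ᵥ η) i := by
  have hε := absolutelyContinuousOnInterval_angleError θs h.1 (by rwa [uIcc_of_le hT])
  have hdiff : ∀ᵐ s ∂(volume.restrict (Icc 0 T)), ∀ i,
      DifferentiableAt ℝ (fun s => |angleError θs (z s) i|) s := by
    refine ae_all_iff.2 fun i => (ae_restrict_iff' measurableSet_Icc).2 ?_
    have := (hε.apply i).norm.ae_differentiableAt
    rwa [uIcc_of_le hT] at this
  filter_upwards [h.2, ae_restrict_mem measurableSet_Icc, hdiff] with s ⟨v, hd, _, hsgn⟩ hs hdiff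
  obtain ⟨η, hη, rfl⟩ := hsgn (hz s hs)
  refine ⟨η, hη, ?_⟩
  have h1 := hasDerivAt_angleError hn θs (hz s hs) hd
  have h2 := HasDerivAt.fun_sum (u := Finset.univ) fun i _ =>
    hasDerivAt_abs_comp (hasDerivAt_pi.1 h1 i) (hdiff i) (mem_filippov_sgn_iff.1 hη i).2
  refine h2.deriv.trans ?_
  simp

theorem V_le (hn : 3 ≤ n) (h : IsMotion θs z T)
    (hz : ∀ s ∈ Icc 0 T, ∀ i, edge (z s) i ≠ 0) {a b : ℝ} (ha : 0 ≤ a) (hab : a ≤ b)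
    (hb : b ≤ T) : V (angleError θs (z b)) ≤ V (angleError θs (z a)) := by
  have hT := ha.trans (hab.trans hb)
  have hsub : Icc a b ⊆ Icc 0 T := Icc_subset_Icc ha hb
  have hac := (h.absolutelyContinuousOnInterval_V hT hz).mono
    (c := a) (d := b) (by rwa [uIcc_of_le hab, uIcc_of_le hT])
  have := hac.le_add_of_ae_deriv_le (c := 0) hab (by
    filter_upwards [ae_restrict_of_ae_restrict_of_subset hsub (h.ae_deriv_V hn hT hz),
      ae_restrict_mem measurableSet_Icc] with s ⟨η, _, hs⟩ hmem
    rw [hs, sum_mul_errorMatrix_mulVec hn (hz s (hsub hmem)), neg_nonpos]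
    exact Finset.sum_nonneg fun i _ => by positivity)
  simpa using this

/-- If the dissipation is at least `κ` as long as the error does not vanish, then the error
vanishes at time `T ≥ V(ε(0)) / κ`. -/
theorem angleError_eq_zero (hn : 3 ≤ n) (h : IsMotion θs z T) (hT : 0 ≤ T)
    (hz : ∀ s ∈ Icc 0 T, ∀ i, edge (z s) i ≠ 0) {κ : ℝ} (hκ : 0 < κ)
    (hdiss : ∀ s ∈ Icc 0 (V (angleError θs (z 0)) / κ), s ≤ T → angleError θs (z s) ≠ 0 →
      ∀ η ∈ filippov sgn (angleError θs (z s)), κ ≤ ∑ i, η i * (errorMatrix (z s) *ᵥ η) i)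
    (hle : V (angleError θs (z 0)) / κ ≤ T) : angleError θs (z T) = 0 := by
  by_contra hne
  set τ := V (angleError θs (z 0)) / κ with hτ
  have hτ0 : 0 ≤ τ := div_nonneg (V_nonneg _) hκ.le
  have hsub : Icc 0 τ ⊆ Icc 0 T := Icc_subset_Icc_right hle
  have hac := (h.absolutelyContinuousOnInterval_V hT hz).mono
    (c := 0) (d := τ) (by rwa [uIcc_of_le hτ0, uIcc_of_le hT])
  have h1 := hac.le_add_of_ae_deriv_le (c := -κ) hτ0 (by
    filter_upwards [ae_restrict_of_ae_restrict_of_subset hsub (h.ae_deriv_V hn hT hz),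
      ae_restrict_mem measurableSet_Icc] with s ⟨η, hη, hs⟩ hmem
    rw [hs, neg_le_neg_iff]
    -- An error vanishing at `s` would stay zero by monotonicity of `V`, contrary to the assumption
    -- at `T`.
    refine hdiss s hmem (hmem.2.trans hle) (fun h0 => hne (eq_zero_of_V_le_zero ?_)) η hη
    refine (h.V_le hn hz hmem.1 (hmem.2.trans hle) le_rfl).trans ?_
    simp [h0, V])
  have h2 : κ * τ = V (angleError θs (z 0)) := mul_div_cancel₀ _ hκ.ne'
  refine hne (eq_zero_of_V_le_zero ((h.V_le hn hz hτ0 hle le_rfl).trans ?_))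
  linarith

end IsMotion

/-! ### Choice of the constants. -/

theorem cos_sq_lt_one_of_mem_Ico {θ : ℝ} (hθ : θ ∈ Ico 0 (2 * Real.pi)) (h0 : θ ≠ 0)
    (hπ : θ ≠ Real.pi) : Real.cos θ ^ 2 < 1 := by
  have hsin : Real.sin θ ≠ 0 := by
    rcases hπ.lt_or_gt with h | h
    · exact (Real.sin_pos_of_pos_of_lt_pi (lt_of_le_of_ne hθ.1 h0.symm) h).ne'
    · rw [← Real.sin_sub_two_pi]
      exact (Real.sin_neg_of_neg_of_neg_pi_lt (by linarith [hθ.2]) (by linarith)).ne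
  have := Real.sin_sq_add_cos_sq θ
  have := pow_pos (abs_pos.2 hsin) 2
  rw [sq_abs] at this
  linarith

end CircularFormation

open CircularFormation in
/-- Local finite-time stability of `ε = 0`, locally uniformly in the size of the initial
formation: for target angles different from `0` and `π`, the rate `κ` depends only on `n`, the
target angles and an upper bound `L` of the initial perimeter, and the size `δ` of the region of
attraction also on a lower bound `d` of the initial inter-vehicle distances. -/
theorem theorem1 (n : ℕ) [NeZero n] (hn : 3 ≤ n) (θs : Fin n → ℝ)
    (hθ : ∀ i, θs i ∈ Set.Ico 0 (2 * Real.pi))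
    (hθ0 : ∀ i, θs i ≠ 0) (hθπ : ∀ i, θs i ≠ Real.pi) :
    ∀ L : ℝ, 0 < L → ∃ κ : ℝ, 0 < κ ∧ ∀ d : ℝ, 0 < d → ∃ δ : ℝ, 0 < δ ∧
      ∀ z₀ : Config n,
        (∀ i j : Fin n, i ≠ j → d ≤ ‖z₀ i - z₀ j‖) →
        (∑ i, ‖edge z₀ i‖) ≤ L →
        V (angleError θs z₀) < δ →
        -- the settling-time bound is below the earliest possible collision time
        V (angleError θs z₀) / κ < collisionTime z₀ ∧
        ∀ (T : ℝ) (z : ℝ → Config n), 0 ≤ T → z 0 = z₀ →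
          (IsFilippovSolution (fun _ => closedLoop θs) z T ∨ IsSignInclusionSolution θs z T) →
          -- no collision before `T*`
          (∀ t ∈ Set.Icc 0 T, t < collisionTime z₀ → NoCollision (z t)) ∧
          -- up to the first collision, `ε` solves the error system, the sublevel sets of `V`
          -- are invariant, and `ε` vanishes from the settling-time bound on
          ∀ t ∈ Set.Icc 0 T, (∀ s ∈ Set.Icc 0 t, NoCollision (z s)) →
            IsFilippovSolution (errorField z) (fun s => angleError θs (z s)) t ∧
            V (angleError θs (z t)) ≤ V (angleError θs z₀) ∧
            (V (angleError θs z₀) / κ ≤ t → angleError θs (z t) = 0) := by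
  intro L hL
  obtain ⟨m, hm, δ, hδ, hrate⟩ := exists_dissipation_rate hn θs fun i =>
    cos_sq_lt_one_of_mem_Ico (hθ i) (hθ0 i) (hθπ i)
  have hκ : 0 < (2 * m) ^ 2 / (2 * L) := by positivity
  -- The perimeter stays below `2 * L` until T*, whence this rate.
  refine ⟨(2 * m) ^ 2 / (2 * L), hκ, fun d hd => ?_⟩
  set κ := (2 * m) ^ 2 / (2 * L)
  -- The second bound makes the settling time less than `d / 4`, hence less than T*.
  refine ⟨min δ (κ * (d / 4)), by positivity, fun z₀ hdist hper hV => ?_⟩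
  have : Nonempty {p : Fin n × Fin n // p.1 ≠ p.2} := ⟨⟨(0 + 1, 0), add_one_ne_self hn 0⟩⟩
  have hcoll : d / 4 ≤ collisionTime z₀ :=
    div_le_div_of_nonneg_right (le_ciInf fun p => hdist _ _ p.2) (by norm_num)
  have hsettle : V (angleError θs z₀) / κ < collisionTime z₀ := by
    refine lt_of_lt_of_le ?_ hcoll
    rw [div_lt_iff₀' hκ]
    exact hV.trans_le (min_le_right _ _)
  refine ⟨hsettle, fun T z hT hz0 hsol => ?_⟩
  subst hz0
  have hmot := isMotion_of_solution hsol
  refine ⟨fun t ht hlt => (hmot.mono ht).noCollision ht.1 hlt, fun t ht hnc => ?_⟩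
  have hmt := hmot.mono ht
  have hedge : ∀ s ∈ Icc 0 t, ∀ i, edge (z s) i ≠ 0 := fun s hs => edge_ne_zero hn (hnc s hs)
  refine ⟨hmt.isFilippovSolution_angleError hn ht.1 hedge, hmt.V_le hn hedge le_rfl ht.1 le_rfl,
    hmt.angleError_eq_zero hn ht.1 hedge hκ fun s hs hst h0 η hη => ?_⟩
  have hVs := hmt.V_le hn hedge le_rfl hs.1 hst
  refine hrate (z s) (hedge s ⟨hs.1, hst⟩) (hVs.trans_lt (hV.trans_le (min_le_left _ _))) h0 η hη _
    (((hmt.mono ⟨hs.1, hst⟩).perimeter_le hn hs.1 (hs.2.trans hsettle.le)).trans ?_)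
  linarith
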